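/- Let $P$ be a non-empty set of atoms and $A$ a finite set of agents. Formulas and action formulas of arbitrary action formula logic are defined by simultaneous induction: $$\varphi ::= p \mid \neg\varphi \mid (\varphi\wedge\varphi) \mid \Box_a\varphi \mid [\alpha]\varphi \mid \forall\varphi, \qquad \alpha ::= {?\varphi} \mid \alpha\sqcup\alpha \mid \alpha;\alpha \mid L_B(\alpha,\alpha),$$ where $p\in P$, $a\in A$, $\emptyset\neq B\subseteq A$. The intended meaning of $\forall\varphi$ is that $\varphi$ holds in every refinement of the current pointed Kripke model. Put $\Diamond_a=\neg\Box_a\neg$, $\langle\alpha\rangle=\neg[\alpha]\neg$, $\exists=\neg\forall\neg$, and $\nabla_a\Gamma=\Box_a\bigvee_{\gamma\in\Gamma}\gamma\wedge\bigwedge_{\gamma\in\Gamma}\Diamond_a\gamma$ for finite $\Gamma$. A formula or action formula is *refinement-free* if $\forall$ does not occur in it (nor in any test in it). Let $\vdash$ be provability in the following system over the class of all Kripke models. Its axioms and rules are: all instances of propositional tautologies; $\Box_a(\varphi\to\psi)\to(\Box_a\varphi\to\Box_a\psi)$; modus ponens; necessitation for $\Box_a$, for $[\alpha]$ and for $\forall$;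 replacement of provable equivalents under $[\alpha]$ (from $\vdash\varphi\leftrightarrow\psi$ infer $\vdash[\alpha]\varphi\leftrightarrow[\alpha]\psi$); the action axioms - (LT) $[?\varphi]\psi\leftrightarrow(\varphi\to\psi)$ for $\psi$ built from atoms with $\neg,\wedge,\Box_a$ only; - (LU) $[\alpha\sqcup\beta]\varphi\leftrightarrow([\alpha]\varphi\wedge[\beta]\varphi)$; - (LS) $[\alpha;\beta]\varphi\leftrightarrow[\alpha][\beta]\varphi$; - (LP) $[L_B(\alpha,\beta)]p\leftrightarrow p$ for atoms $p$; - (LN) $[L_B(\alpha,\beta)]\neg\varphi\leftrightarrow\neg[L_B(\alpha,\beta)]\varphi$; - (LC) $[L_B(\alpha,\beta)](\varphi\wedge\psi)\leftrightarrow([L_B(\alpha,\beta)]\varphi\wedge[L_B(\alpha,\beta)]\psi)$; - (LK1) $[L_B(\alpha,\beta)]\Box_a\varphi\leftrightarrow\Box_a[\alpha\sqcup\beta]\varphi$ for $a\in B$; - (LK2) $[L_B(\alpha,\beta)]\Box_a\varphi\leftrightarrow\Box_a\varphi$ for $a\notin B$; and the refinement axioms - (R) $\forall(\varphi\to\psi)\to(\forall\varphi\to\forall\psi)$;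 - (RP) $\forall\pi\leftrightarrow\pi$ for propositional $\pi$ (built from atoms with $\neg,\wedge$ only); - (RK) $\exists\nabla_a\Gamma\leftrightarrow\bigwedge_{\gamma\in\Gamma}\Diamond_a\exists\gamma$; - (RDist) $\exists\bigwedge_{a\in A}\nabla_a\Gamma_a\leftrightarrow\bigwedge_{a\in A}\exists\nabla_a\Gamma_a$. **Proposition.** For every refinement-free formula $\varphi$ there is a refinement-free action formula $\alpha$ such that $$\vdash[\alpha]\varphi\qquad\text{and}\qquad\vdash\exists\varphi\to\langle\alpha\rangle\varphi.$$ So $\alpha$ is guaranteed to achieve $\varphi$, and it is executable with result $\varphi$ whenever $\varphi$ is achievable by some refinement. -/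

import Mathlib

namespace ActionFormulaLogic

universe u v

mutual

/-- Formulas of arbitrary action formula logic over the atoms `Atom` and the agents `Ag`:
`p`, `¬φ`, `φ ∧ ψ`, `□ₐ φ`, `[α] φ` and `∀φ` (truth in all refinements). -/
inductive Formula (Atom : Type u) (Ag : Type v) : Type (max u v)
  | atom (p : Atom) : Formula Atom Ag
  | neg (φ : Formula Atom Ag) : Formula Atom Ag
  | and (φ ψ : Formula Atom Ag) : Formula Atom Ag
  | box (a : Ag) (φ : Formula Atom Ag) : Formula Atom Ag
  | allActs (α : ActionFormula Atom Ag) (φ : Formula Atom Ag) : Formula Atom Ag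
  | allRefs (φ : Formula Atom Ag) : Formula Atom Ag

/-- Action formulas: the test `?φ`, the choice `α ⊔ β`, the sequential execution `α ; β`
(first `α`, then `β`) and the learning operator `L_B(α, β)` for a non-empty set `B` of agents. -/
inductive ActionFormula (Atom : Type u) (Ag : Type v) : Type (max u v)
  | test (φ : Formula Atom Ag) : ActionFormula Atom Ag
  | choice (α β : ActionFormula Atom Ag) : ActionFormula Atom Ag
  | seq (α β : ActionFormula Atom Ag) : ActionFormula Atom Ag
  | learn (B : Finset Ag) (hB : B.Nonempty) (α β : ActionFormula Atom Ag) : ActionFormula Atom Ag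

end

mutual

/-- The formulas of action formula logic: no refinement quantifier occurs, not even inside
the tests of an action formula. -/
def Formula.RefFree {Atom : Type u} {Ag : Type v} : Formula Atom Ag → Prop
  | .atom _ => True
  | .neg φ => φ.RefFree
  | .and φ ψ => φ.RefFree ∧ ψ.RefFree
  | .box _ φ => φ.RefFree
  | .allActs α φ => α.RefFree ∧ φ.RefFree
  | .allRefs _ => False

/-- The action formulas of action formula logic: no refinement quantifier occurs in any test. -/
def ActionFormula.RefFree {Atom : Type u} {Ag : Type v} : ActionFormula Atom Ag → Prop
  | .test φ => φ.RefFree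
  | .choice α β => α.RefFree ∧ β.RefFree
  | .seq α β => α.RefFree ∧ β.RefFree
  | .learn _ _ α β => α.RefFree ∧ β.RefFree

end

namespace Formula

/-- Formulas of modal logic: built from atoms with `¬`, `∧` and `□ₐ` only. -/
inductive IsModal {Atom : Type u} {Ag : Type v} : Formula Atom Ag → Prop
  | atom (p : Atom) : IsModal (.atom p)
  | neg {φ : Formula Atom Ag} : IsModal φ → IsModal (.neg φ)
  | and {φ ψ : Formula Atom Ag} : IsModal φ → IsModal ψ → IsModal (.and φ ψ)
  | box (a : Ag) {φ : Formula Atom Ag} : IsModal φ → IsModal (.box a φ)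

/-- Formulas of propositional logic: built from atoms with `¬` and `∧` only. -/
inductive IsPropositional {Atom : Type u} {Ag : Type v} : Formula Atom Ag → Prop
  | atom (p : Atom) : IsPropositional (.atom p)
  | neg {φ : Formula Atom Ag} : IsPropositional φ → IsPropositional (.neg φ)
  | and {φ ψ : Formula Atom Ag} : IsPropositional φ → IsPropositional ψ →
      IsPropositional (.and φ ψ)

variable {Atom : Type u} {Ag : Type v}

/-- `φ ∨ ψ`. -/
def or (φ ψ : Formula Atom Ag) : Formula Atom Ag := .neg (.and (.neg φ) (.neg ψ))

/-- `φ → ψ`. -/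
def imp (φ ψ : Formula Atom Ag) : Formula Atom Ag := .neg (.and φ (.neg ψ))

/-- `φ ↔ ψ`. -/
def iff (φ ψ : Formula Atom Ag) : Formula Atom Ag := .and (φ.imp ψ) (ψ.imp φ)

/-- `⊥`, the contradiction `p ∧ ¬p` for a fixed atom `p`. -/
noncomputable def bot [Nonempty Atom] : Formula Atom Ag :=
  .and (.atom (Classical.arbitrary Atom)) (.neg (.atom (Classical.arbitrary Atom)))

/-- `⊤`. -/
noncomputable def top [Nonempty Atom] : Formula Atom Ag := .neg bot

/-- `◇ₐ φ`. -/
def dia (a : Ag) (φ : Formula Atom Ag) : Formula Atom Ag := .neg (.box a (.neg φ))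

/-- `⟨α⟩ φ`: some successful execution of `α` leads to `φ`. -/
def someActs (α : ActionFormula Atom Ag) (φ : Formula Atom Ag) : Formula Atom Ag :=
  .neg (.allActs α (.neg φ))

/-- `∃φ`: some refinement satisfies `φ`. -/
def someRefs (φ : Formula Atom Ag) : Formula Atom Ag := .neg (.allRefs (.neg φ))

/-- The conjunction of a finite list of formulas; `⊤` for the empty list. -/
noncomputable def bigAnd [Nonempty Atom] : List (Formula Atom Ag) → Formula Atom Ag
  | [] => top
  | φ :: Γ => .and φ (bigAnd Γ)

/-- The disjunction of a finite list of formulas; `⊥` for the empty list. -/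
noncomputable def bigOr [Nonempty Atom] : List (Formula Atom Ag) → Formula Atom Ag
  | [] => bot
  | φ :: Γ => φ.or (bigOr Γ)

/-- The cover operator `∇ₐ Γ = □ₐ ⋁ Γ ∧ ⋀ {◇ₐ γ | γ ∈ Γ}`, the finite set `Γ` being
given by a list of its elements. -/
noncomputable def cover [Nonempty Atom] (a : Ag) (Γ : List (Formula Atom Ag)) : Formula Atom Ag :=
  .and (.box a (bigOr Γ)) (bigAnd (Γ.map (dia a)))

/-- Substitution instances of propositional tautologies: formulas that are true under every
truth assignment to all formulas that respects `¬` and `∧`. -/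
def IsTautology (φ : Formula Atom Ag) : Prop :=
  ∀ V : Formula Atom Ag → Prop,
    (∀ ψ, V (.neg ψ) ↔ ¬ V ψ) → (∀ ψ χ, V (.and ψ χ) ↔ (V ψ ∧ V χ)) → V φ

end Formula

open Formula in
/-- Theorems of arbitrary action formula logic over the class of all Kripke models: the multi-agent
modal logic K, the axioms for action formulas and the axioms for the refinement quantifier.
All axioms are schemata over the whole language, except where a restriction is displayed. -/
inductive Provable {Atom : Type u} {Ag : Type v} [Nonempty Atom] [Fintype Ag] :
    Formula Atom Ag → Prop
  -- modal logic K
  | P {φ} : IsTautology φ → Provable φ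
  | K (a φ ψ) : Provable (imp (.box a (imp φ ψ)) (imp (.box a φ) (.box a ψ)))
  | MP {φ ψ} : Provable (imp φ ψ) → Provable φ → Provable ψ
  | NecK (a) {φ} : Provable φ → Provable (.box a φ)
  -- action formulas
  | LT (φ) {ψ} : IsModal ψ → Provable (iff (.allActs (.test φ) ψ) (imp φ ψ))
  | LU (α β φ) :
      Provable (iff (.allActs (.choice α β) φ) (.and (.allActs α φ) (.allActs β φ)))
  | LS (α β φ) : Provable (iff (.allActs (.seq α β) φ) (.allActs α (.allActs β φ)))
  | LP (B hB α β p) : Provable (iff (.allActs (.learn B hB α β) (.atom p)) (.atom p))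
  | LN (B hB α β φ) : Provable
      (iff (.allActs (.learn B hB α β) (.neg φ)) (.neg (.allActs (.learn B hB α β) φ)))
  | LC (B hB α β φ ψ) : Provable
      (iff (.allActs (.learn B hB α β) (.and φ ψ))
        (.and (.allActs (.learn B hB α β) φ) (.allActs (.learn B hB α β) ψ)))
  | LK1 (B hB α β φ) {a} : a ∈ B → Provable
      (iff (.allActs (.learn B hB α β) (.box a φ)) (.box a (.allActs (.choice α β) φ)))
  | LK2 (B hB α β φ) {a} : a ∉ B → Provable
      (iff (.allActs (.learn B hB α β) (.box a φ)) (.box a φ))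
  | NecL (α) {φ} : Provable φ → Provable (.allActs α φ)
  -- replacement of provable equivalents in the scope of an action modality
  | RE (α) {φ ψ} : Provable (iff φ ψ) → Provable (iff (.allActs α φ) (.allActs α ψ))
  -- refinement quantifier
  | R (φ ψ) : Provable (imp (.allRefs (imp φ ψ)) (imp (.allRefs φ) (.allRefs ψ)))
  | RP {π} : IsPropositional π → Provable (iff (.allRefs π) π)
  | RK (a) (Γ : List (Formula Atom Ag)) : Provable
      (iff (someRefs (cover a Γ)) (bigAnd (Γ.map fun γ => dia a (someRefs γ))))
  | RDist (Γ : Ag → List (Formula Atom Ag)) : Provable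
      (iff (someRefs (bigAnd ((Finset.univ : Finset Ag).toList.map fun a => cover a (Γ a))))
        (bigAnd ((Finset.univ : Finset Ag).toList.map fun a => someRefs (cover a (Γ a)))))
  | NecR {φ} : Provable φ → Provable (.allRefs φ)

end ActionFormulaLogic

-- The action axioms push `[α]` inward until it disappears, so a refinement-free formula is provably
-- equivalent to a modal one (`exists_isModal_iff`). Synthesis for modal formulas is a strong
-- induction on modal depth. A disjunction is achieved by choice (`Synthesizable.or`), which leaves
-- conjunctions of literals `p`, `¬p`, `□ₐψ`, `¬□ₐψ` with `ψ` of smaller depth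
-- (`synthesizable_bigAnd`).
--
-- For such a conjunction `φ`, let `φₐ` be the conjunction of all `ψ` with `□ₐψ` in it, and let `αₐ`
-- be the choice of the actions synthesized for `φₐ ∧ ¬ψ`, one for each `¬□ₐψ`. Let `β` make each
-- agent `a` learn `αₐ` separately. The boxes hold after `β` because every branch of `αₐ` guarantees
-- `φₐ`. If `∃φ`, the left-to-right half of (RK) gives `◇ₐ∃(φₐ ∧ ¬ψ)`, so some execution of `αₐ`
-- makes `ψ` fail at an `a`-successor. Hence `∃φ → [β]φ`, and since `β` is deterministic and always
-- executable, `?[β]φ ; β` is the required action.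

namespace ActionFormulaLogic

universe u v

variable {Atom : Type u} {Ag : Type v}

-- Truth assignments for propositional reasoning

/-- Truth assignments to all formulas that respect `¬` and `∧`. -/
structure Valuation (Atom : Type u) (Ag : Type v) where
  /-- The formulas that are assigned truth. -/
  holds : Formula Atom Ag → Prop
  holds_neg : ∀ φ, holds (.neg φ) ↔ ¬ holds φ
  holds_and : ∀ φ ψ, holds (.and φ ψ) ↔ (holds φ ∧ holds ψ)

namespace Valuation

attribute [grind =, simp] holds_neg holds_and

variable (v : Valuation Atom Ag)

@[grind =, simp]
theorem holds_or (φ ψ : Formula Atom Ag) : v.holds (φ.or ψ) ↔ (v.holds φ ∨ v.holds ψ) := by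
  simp only [Formula.or, holds_neg, holds_and]; tauto

@[grind =, simp]
theorem holds_imp (φ ψ : Formula Atom Ag) : v.holds (φ.imp ψ) ↔ (v.holds φ → v.holds ψ) := by
  simp only [Formula.imp, holds_neg, holds_and]; tauto

@[grind =, simp]
theorem holds_iff (φ ψ : Formula Atom Ag) : v.holds (φ.iff ψ) ↔ (v.holds φ ↔ v.holds ψ) := by
  simp only [Formula.iff, holds_imp, holds_and]; tauto

@[grind =, simp]
theorem holds_bot [Nonempty Atom] : v.holds (.bot : Formula Atom Ag) ↔ False := by
  simp [Formula.bot]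

@[grind =, simp]
theorem holds_top [Nonempty Atom] : v.holds (.top : Formula Atom Ag) ↔ True := by
  simp [Formula.top]

@[grind =, simp]
theorem holds_dia (a : Ag) (φ : Formula Atom Ag) :
    v.holds (.dia a φ) ↔ ¬ v.holds (.box a (.neg φ)) := by
  simp [Formula.dia]

@[grind =, simp]
theorem holds_someActs (α : ActionFormula Atom Ag) (φ : Formula Atom Ag) :
    v.holds (.someActs α φ) ↔ ¬ v.holds (.allActs α (.neg φ)) := by
  simp [Formula.someActs]

@[grind =, simp]
theorem holds_someRefs (φ : Formula Atom Ag) :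
    v.holds (.someRefs φ) ↔ ¬ v.holds (.allRefs (.neg φ)) := by
  simp [Formula.someRefs]

@[grind =, simp]
theorem holds_bigAnd_nil [Nonempty Atom] :
    v.holds (.bigAnd ([] : List (Formula Atom Ag))) ↔ True := by
  simp [Formula.bigAnd]

@[grind =, simp]
theorem holds_bigAnd_cons [Nonempty Atom] (φ : Formula Atom Ag) (Γ : List (Formula Atom Ag)) :
    v.holds (.bigAnd (φ :: Γ)) ↔ (v.holds φ ∧ v.holds (.bigAnd Γ)) := by
  simp [Formula.bigAnd]

theorem holds_of_mem_bigAnd [Nonempty Atom] {φ : Formula Atom Ag} {Γ : List (Formula Atom Ag)}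
    (h : φ ∈ Γ) (hΓ : v.holds (.bigAnd Γ)) : v.holds φ := by
  induction Γ with
  | nil => simp at h
  | cons ψ Γ ih => grind

end Valuation

-- Syntactic fragments

namespace Formula

theorem IsModal.refFree {φ : Formula Atom Ag} (h : φ.IsModal) : φ.RefFree := by
  induction h with
  | atom => simp [RefFree]
  | neg _ ih => simpa [RefFree] using ih
  | and _ _ ih₁ ih₂ => simpa [RefFree] using ⟨ih₁, ih₂⟩
  | box _ _ ih => simpa [RefFree] using ih

theorem IsModal.imp {φ ψ : Formula Atom Ag} (hφ : φ.IsModal) (hψ : ψ.IsModal) :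
    (φ.imp ψ).IsModal := .neg (.and hφ (.neg hψ))

theorem isModal_bot [Nonempty Atom] : (bot : Formula Atom Ag).IsModal :=
  .and (.atom _) (.neg (.atom _))

theorem isModal_top [Nonempty Atom] : (top : Formula Atom Ag).IsModal := .neg isModal_bot

theorem refFree_bigAnd [Nonempty Atom] {Γ : List (Formula Atom Ag)} (h : ∀ φ ∈ Γ, φ.RefFree) :
    (bigAnd Γ).RefFree := by
  induction Γ with
  | nil => exact isModal_top.refFree
  | cons φ Γ ih =>
    simp only [bigAnd, Formula.RefFree]
    exact ⟨h φ (by simp), ih fun ψ hψ => h ψ (by simp [hψ])⟩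

end Formula

open Formula

-- Derived rules for boxes and refinement quantifiers

namespace Provable

variable [Nonempty Atom] [Fintype Ag] {φ ψ χ θ ρ : Formula Atom Ag}

theorem taut (h : ∀ v : Valuation Atom Ag, v.holds φ) : Provable φ :=
  .P fun V hn ha => h ⟨V, hn, ha⟩

theorem cons (h₁ : Provable φ) (h : ∀ v : Valuation Atom Ag, v.holds φ → v.holds ψ) :
    Provable ψ :=
  .MP (taut fun v => (v.holds_imp _ _).2 (h v)) h₁

theorem cons₂ (h₁ : Provable φ) (h₂ : Provable ψ)
    (h : ∀ v : Valuation Atom Ag, v.holds φ → v.holds ψ → v.holds χ) : Provable χ :=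
  .MP (h₁.cons (ψ := ψ.imp χ) fun v hv => (v.holds_imp _ _).2 (h v hv)) h₂

theorem cons₃ (h₁ : Provable φ) (h₂ : Provable ψ) (h₃ : Provable χ)
    (h : ∀ v : Valuation Atom Ag, v.holds φ → v.holds ψ → v.holds χ → v.holds θ) :
    Provable θ :=
  .MP (cons₂ h₁ h₂ (χ := χ.imp θ) fun v hv hw => (v.holds_imp _ _).2 (h v hv hw)) h₃

theorem cons₄ (h₁ : Provable φ) (h₂ : Provable ψ) (h₃ : Provable χ) (h₄ : Provable θ)
    (h : ∀ v : Valuation Atom Ag, v.holds φ → v.holds ψ → v.holds χ → v.holds θ → v.holds ρ) :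
    Provable ρ :=
  .MP (cons₃ h₁ h₂ h₃ (θ := θ.imp ρ) fun v hv hw hx => (v.holds_imp _ _).2 (h v hv hw hx)) h₄

theorem iff_refl (φ : Formula Atom Ag) : Provable (φ.iff φ) := taut fun v => by simp

theorem iff_symm (h : Provable (φ.iff ψ)) : Provable (ψ.iff φ) := h.cons fun v => by grind

theorem iff_trans (h₁ : Provable (φ.iff ψ)) (h₂ : Provable (ψ.iff χ)) : Provable (φ.iff χ) :=
  cons₂ h₁ h₂ fun v => by grind

theorem imp_trans (h₁ : Provable (φ.imp ψ)) (h₂ : Provable (ψ.imp χ)) : Provable (φ.imp χ) :=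
  cons₂ h₁ h₂ fun v => by grind

theorem neg_congr (h : Provable (φ.iff ψ)) : Provable (φ.neg.iff ψ.neg) :=
  h.cons fun v => by grind

theorem and_congr (h₁ : Provable (φ.iff ψ)) (h₂ : Provable (χ.iff θ)) :
    Provable ((φ.and χ).iff (ψ.and θ)) :=
  cons₂ h₁ h₂ fun v => by grind

theorem box_mono (a : Ag) (h : Provable (φ.imp ψ)) : Provable ((box a φ).imp (box a ψ)) :=
  .MP (.K a φ ψ) (.NecK a h)

theorem box_congr (a : Ag) (h : Provable (φ.iff ψ)) : Provable ((box a φ).iff (box a ψ)) :=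
  cons₂ (box_mono a (φ := φ) (ψ := ψ) (h.cons fun v => by grind))
    (box_mono a (φ := ψ) (ψ := φ) (h.cons fun v => by grind)) fun v => by grind

theorem box_mono₂ (a : Ag) (h : Provable (φ.imp (ψ.imp χ))) :
    Provable ((box a φ).imp ((box a ψ).imp (box a χ))) :=
  imp_trans (box_mono a h) (.K a ψ χ)

theorem box_and (a : Ag) (φ ψ : Formula Atom Ag) :
    Provable ((box a φ).imp ((box a ψ).imp (box a (φ.and ψ)))) :=
  box_mono₂ a (taut fun v => by grind)

theorem allRefs_mono (h : Provable (φ.imp ψ)) : Provable (φ.allRefs.imp ψ.allRefs) :=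
  .MP (.R φ ψ) (.NecR h)

theorem someRefs_mono (h : Provable (φ.imp ψ)) : Provable (φ.someRefs.imp ψ.someRefs) :=
  (allRefs_mono (φ := ψ.neg) (ψ := φ.neg) (h.cons fun v => by grind)).cons fun v => by grind

theorem someRefs_or (φ ψ : Formula Atom Ag) :
    Provable ((φ.or ψ).someRefs.imp (φ.someRefs.or ψ.someRefs)) := by
  have h : Provable (φ.neg.allRefs.imp (ψ.neg.imp (φ.or ψ).neg).allRefs) :=
    allRefs_mono (taut fun v => by grind)
  exact cons₂ h (.R ψ.neg (φ.or ψ).neg) fun v => by grind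

theorem someRefs_of_isPropositional (h : φ.IsPropositional) : Provable (φ.someRefs.imp φ) :=
  (Provable.RP h.neg).cons fun v => by grind

/-- The premise under `∃` implies a cover, to which (RK) applies. The element `φ` is added to the
cover so that its disjunction exhausts `φ`; its own diamond follows from that of `φ ∧ ¬ψ`. -/
theorem someRefs_box_and_neg_box (a : Ag) (φ ψ : Formula Atom Ag) :
    Provable (((box a φ).and (box a ψ).neg).someRefs.imp (dia a (φ.and ψ.neg).someRefs)) := by
  have h₁ : Provable (((box a φ).and (box a ψ).neg).imp (cover a [φ.and ψ.neg, φ])) := by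
    refine cons₃ (box_mono a (φ := φ) (ψ := bigOr [φ.and ψ.neg, φ]) ?_)
      (box_mono₂ a (φ := φ) (ψ := (φ.and ψ.neg).neg) (χ := ψ) ?_)
      (box_mono₂ a (φ := φ) (ψ := φ.neg) (χ := ψ) ?_) fun v => ?_
    · exact taut fun v => by simp only [bigOr]; grind
    · exact taut fun v => by grind
    · exact taut fun v => by grind
    · simp only [cover, List.map]; grind
  refine cons₂ (someRefs_mono h₁) (.RK a [φ.and ψ.neg, φ]) fun v => ?_
  simp only [List.map]; grind

end Provable

-- Elimination of action modalities

section Reduction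

variable [Nonempty Atom] [Fintype Ag]

open Provable

mutual

theorem exists_isModal_iff : ∀ φ : Formula Atom Ag, φ.RefFree →
    ∃ ψ : Formula Atom Ag, ψ.IsModal ∧ Provable (φ.iff ψ)
  | .atom p, _ => ⟨.atom p, .atom p, iff_refl _⟩
  | .neg φ, h => by
    obtain ⟨φ', hφ, h₁⟩ := exists_isModal_iff φ (by simpa [Formula.RefFree] using h)
    exact ⟨φ'.neg, hφ.neg, neg_congr h₁⟩
  | .and φ ψ, h => by
    simp only [Formula.RefFree] at h
    obtain ⟨φ', hφ, h₁⟩ := exists_isModal_iff φ h.1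
    obtain ⟨ψ', hψ, h₂⟩ := exists_isModal_iff ψ h.2
    exact ⟨φ'.and ψ', hφ.and hψ, and_congr h₁ h₂⟩
  | .box a φ, h => by
    obtain ⟨φ', hφ, h₁⟩ := exists_isModal_iff φ (by simpa [Formula.RefFree] using h)
    exact ⟨box a φ', hφ.box a, box_congr a h₁⟩
  | .allActs α φ, h => by
    simp only [Formula.RefFree] at h
    obtain ⟨φ', hφ, h₁⟩ := exists_isModal_iff φ h.2
    obtain ⟨ψ, hψ, h₂⟩ := exists_isModal_iff_allActs α h.1 φ' hφ
    exact ⟨ψ, hψ, iff_trans (.RE α h₁) h₂⟩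
  | .allRefs _, h => by simp [Formula.RefFree] at h

/-- The recursion is on `α` for all modal `φ` at once, because a sequence applies it to the reduct
of `[β]φ`. For learning, an inner induction on `φ` carries the modality down to a box, where (LK1)
passes to the smaller actions and (LK2) removes it. -/
theorem exists_isModal_iff_allActs : ∀ α : ActionFormula Atom Ag, α.RefFree →
    ∀ φ : Formula Atom Ag, φ.IsModal →
      ∃ ψ : Formula Atom Ag, ψ.IsModal ∧ Provable ((allActs α φ).iff ψ)
  | .test χ, h, φ, hφ => by
    obtain ⟨χ', hχ, h₁⟩ := exists_isModal_iff χ (by simpa [ActionFormula.RefFree] using h)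
    exact ⟨χ'.imp φ, hχ.imp hφ, cons₂ (.LT χ hφ) h₁ fun v => by grind⟩
  | .choice α β, h, φ, hφ => by
    simp only [ActionFormula.RefFree] at h
    obtain ⟨ψ, hψ, h₁⟩ := exists_isModal_iff_allActs α h.1 φ hφ
    obtain ⟨χ, hχ, h₂⟩ := exists_isModal_iff_allActs β h.2 φ hφ
    exact ⟨ψ.and χ, hψ.and hχ, iff_trans (.LU α β φ) (and_congr h₁ h₂)⟩
  | .seq α β, h, φ, hφ => by
    simp only [ActionFormula.RefFree] at h
    obtain ⟨ψ, hψ, h₁⟩ := exists_isModal_iff_allActs β h.2 φ hφ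
    obtain ⟨χ, hχ, h₂⟩ := exists_isModal_iff_allActs α h.1 ψ hψ
    exact ⟨χ, hχ, iff_trans (.LS α β φ) (iff_trans (.RE α h₁) h₂)⟩
  | .learn B hB α β, h, φ, hφ => by
    simp only [ActionFormula.RefFree] at h
    have hα := exists_isModal_iff_allActs α h.1
    have hβ := exists_isModal_iff_allActs β h.2
    induction hφ with
    | atom p => exact ⟨.atom p, .atom p, .LP B hB α β p⟩
    | neg _ ih =>
      obtain ⟨ψ, hψ, h₁⟩ := ih
      exact ⟨ψ.neg, hψ.neg, iff_trans (.LN B hB α β _) (neg_congr h₁)⟩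
    | and _ _ ih₁ ih₂ =>
      obtain ⟨ψ, hψ, h₁⟩ := ih₁
      obtain ⟨χ, hχ, h₂⟩ := ih₂
      exact ⟨ψ.and χ, hψ.and hχ, iff_trans (.LC B hB α β _ _) (and_congr h₁ h₂)⟩
    | @box a φ hφ _ =>
      by_cases ha : a ∈ B
      · obtain ⟨ψ, hψ, h₁⟩ := hα φ hφ
        obtain ⟨χ, hχ, h₂⟩ := hβ φ hφ
        exact ⟨box a (ψ.and χ), (hψ.and hχ).box a, iff_trans (.LK1 B hB α β φ ha)
          (box_congr a (iff_trans (.LU α β φ) (and_congr h₁ h₂)))⟩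
      · exact ⟨box a φ, hφ.box a, .LK2 B hB α β φ ha⟩

end

variable {φ ψ : Formula Atom Ag}

/-- Reduction to a modal equivalent, together with `RE`, lifts the restriction in (LT). -/
theorem Provable.allActs_test (χ : Formula Atom Ag) (hφ : φ.RefFree) :
    Provable ((allActs (.test χ) φ).iff (χ.imp φ)) := by
  obtain ⟨φ', hφ', h⟩ := exists_isModal_iff φ hφ
  exact cons₃ (.RE (.test χ) h) (.LT χ hφ') h fun v => by grind

/-- Normality of `[α]` is not an axiom. It is recovered here by recursion on `α`, and monotonicity
follows from it. -/
theorem Provable.allActs_and (α : ActionFormula Atom Ag) (hα : α.RefFree)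
    {φ ψ : Formula Atom Ag} (hφ : φ.RefFree) (hψ : ψ.RefFree) :
    Provable ((allActs α (φ.and ψ)).iff ((allActs α φ).and (allActs α ψ))) := by
  match α with
  | .test χ =>
    exact cons₃ (allActs_test χ hφ) (allActs_test χ hψ)
      (allActs_test χ (φ := φ.and ψ) (by simpa [Formula.RefFree] using ⟨hφ, hψ⟩))
      fun v => by grind
  | .choice α β =>
    simp only [ActionFormula.RefFree] at hα
    refine cons₂ (and_congr (.LU α β φ) (.LU α β ψ)) (cons₃ (.LU α β (φ.and ψ))
      (allActs_and α hα.1 hφ hψ) (allActs_and β hα.2 hφ hψ) (θ := Formula.iff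
        (allActs (.choice α β) (φ.and ψ)) (((allActs α φ).and (allActs β φ)).and
          ((allActs α ψ).and (allActs β ψ)))) fun v => by grind) fun v => by grind
  | .seq α β =>
    simp only [ActionFormula.RefFree] at hα
    have h₁ := iff_trans (.RE α (allActs_and β hα.2 hφ hψ))
      (allActs_and α hα.1 (by simpa [Formula.RefFree] using ⟨hα.2, hφ⟩)
        (by simpa [Formula.RefFree] using ⟨hα.2, hψ⟩))
    exact cons₄ (.LS α β φ) (.LS α β ψ) (.LS α β (φ.and ψ)) h₁ fun v => by grind
  | .learn B hB α β => exact .LC B hB α β φ ψ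

theorem Provable.allActs_mono {α : ActionFormula Atom Ag} (hα : α.RefFree) (hφ : φ.RefFree)
    (hψ : ψ.RefFree) (h : Provable (φ.imp ψ)) :
    Provable ((allActs α φ).imp (allActs α ψ)) :=
  cons₂ (.RE α (h.cons (ψ := φ.iff (φ.and ψ)) fun v => by grind)) (allActs_and α hα hφ hψ)
    fun v => by grind

end Reduction

-- Separate learning by each agent

section LearnEach

variable [Nonempty Atom]

/-- Every agent `a` in the list `l` separately learns the action formula `α a`. -/
noncomputable def learnEach (α : Ag → ActionFormula Atom Ag) : List Ag → ActionFormula Atom Ag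
  | [] => .test top
  | a :: l => .seq (.learn {a} (Finset.singleton_nonempty a) (α a) (α a)) (learnEach α l)

variable {α : Ag → ActionFormula Atom Ag}

theorem learnEach_refFree (hα : ∀ a, (α a).RefFree) (l : List Ag) :
    (learnEach α l).RefFree := by
  induction l with
  | nil => simpa [learnEach, ActionFormula.RefFree] using isModal_top.refFree
  | cons a l ih => simp [learnEach, ActionFormula.RefFree, hα, ih]

open Provable

variable [Fintype Ag] {φ : Formula Atom Ag}

theorem learnEach_atom (l : List Ag) (p : Atom) :
    Provable ((allActs (learnEach α l) (.atom p)).iff (.atom p)) := by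
  induction l with
  | nil =>
    exact (allActs_test top (φ := .atom p) (IsModal.atom p).refFree).cons
      fun v => by simp only [learnEach]; grind
  | cons a l ih => exact iff_trans (.LS _ _ _) (iff_trans (.RE _ ih) (.LP _ _ _ _ _))

/-- Learning is deterministic and always executable, by (LN), and so is a sequence of learnings
ending in the test of `⊤`. -/
theorem learnEach_neg (l : List Ag) (hφ : φ.RefFree) :
    Provable ((allActs (learnEach α l) φ.neg).iff (allActs (learnEach α l) φ).neg) := by
  induction l with
  | nil =>
    exact cons₂ (allActs_test top hφ)
      (allActs_test top (φ := φ.neg) (by simpa [Formula.RefFree] using hφ)) fun v => by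
        simp only [learnEach]; grind
  | cons a l ih =>
    exact iff_trans (.LS _ _ _) (iff_trans (.RE _ ih)
      (iff_trans (.LN _ _ _ _ _) (neg_congr (iff_symm (.LS _ _ _)))))

theorem learnEach_box_of_notMem (l : List Ag) (hφ : φ.RefFree) {b : Ag} (hb : b ∉ l) :
    Provable ((allActs (learnEach α l) (box b φ)).iff (box b φ)) := by
  induction l with
  | nil =>
    exact (allActs_test top (φ := box b φ) (by simpa [Formula.RefFree] using hφ)).cons
      fun v => by simp only [learnEach]; grind
  | cons a l ih =>
    simp only [List.mem_cons, not_or] at hb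
    exact iff_trans (.LS _ _ _) (iff_trans (.RE _ (ih hb.2))
      (.LK2 _ _ _ _ _ (by simpa using hb.1)))

/-- Only the step in which `b` learns affects `□_b`, by (LK1); (LK2) makes the others transparent.
Without repetitions there is exactly one such step. -/
theorem learnEach_box_of_mem {l : List Ag} (hl : l.Nodup) (hφ : φ.RefFree) {b : Ag}
    (hb : b ∈ l) :
    Provable ((allActs (learnEach α l) (box b φ)).iff (box b (allActs (α b) φ))) := by
  induction l with
  | nil => simp at hb
  | cons a l ih =>
    rw [List.nodup_cons] at hl
    by_cases hab : b = a
    · subst hab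
      have h : Provable ((allActs (.choice (α b) (α b)) φ).iff (allActs (α b) φ)) :=
        (Provable.LU (α b) (α b) φ).cons fun v => by grind
      exact iff_trans (.LS _ _ _) (iff_trans (.RE _ (learnEach_box_of_notMem l hφ hl.1))
        (iff_trans (.LK1 _ _ _ _ _ (by simp)) (box_congr b h)))
    · have hb' : b ∈ l := by simpa [hab] using hb
      exact iff_trans (.LS _ _ _) (iff_trans (.RE _ (ih hl.2 hb'))
        (.LK2 _ _ _ _ _ (by simpa using hab)))

end LearnEach

-- Synthesis for conjunctions of literals

section Synthesis

/-- Atoms and boxed members of `S`, and their negations. -/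
inductive IsLiteral (S : Formula Atom Ag → Prop) : Formula Atom Ag → Prop
  | atom (p : Atom) : IsLiteral S (.atom p)
  | negAtom (p : Atom) : IsLiteral S (.neg (.atom p))
  | box (a : Ag) {φ : Formula Atom Ag} : S φ → IsLiteral S (.box a φ)
  | negBox (a : Ag) {φ : Formula Atom Ag} : S φ → IsLiteral S (.neg (.box a φ))

theorem IsLiteral.refFree {S : Formula Atom Ag → Prop} {φ : Formula Atom Ag}
    (hS : ∀ φ, S φ → φ.RefFree) (h : IsLiteral S φ) : φ.RefFree := by
  cases h with
  | atom => simp [Formula.RefFree]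
  | negAtom => simp [Formula.RefFree]
  | box a h => simpa [Formula.RefFree] using hS _ h
  | negBox a h => simpa [Formula.RefFree] using hS _ h

variable [Nonempty Atom] [Fintype Ag]

open Provable

/-- A refinement-free action formula is guaranteed to achieve `φ`, and can be executed with
result `φ` whenever some refinement satisfies `φ`. -/
def Synthesizable (φ : Formula Atom Ag) : Prop :=
  ∃ α : ActionFormula Atom Ag, α.RefFree ∧ Provable (allActs α φ) ∧
    Provable (φ.someRefs.imp (someActs α φ))

variable {φ ψ : Formula Atom Ag}

theorem Synthesizable.congr (h : Provable (φ.iff ψ)) (hφ : Synthesizable φ) :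
    Synthesizable ψ := by
  obtain ⟨α, hα, h₁, h₂⟩ := hφ
  refine ⟨α, hα, cons₂ (.RE α h) h₁ fun v => by grind, ?_⟩
  exact cons₃ (.RE α (neg_congr h)) h₂
    (someRefs_mono (φ := ψ) (ψ := φ) (h.cons fun v => by grind)) fun v => by grind

theorem Synthesizable.or (hφ : φ.RefFree) (hψ : ψ.RefFree) (h₁ : Synthesizable φ)
    (h₂ : Synthesizable ψ) : Synthesizable (φ.or ψ) := by
  obtain ⟨α, hα, hα₁, hα₂⟩ := h₁
  obtain ⟨β, hβ, hβ₁, hβ₂⟩ := h₂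
  have hor : (φ.or ψ).RefFree := by simpa [Formula.or, Formula.RefFree] using ⟨hφ, hψ⟩
  have h₁ : Provable (allActs α (φ.or ψ)) :=
    .MP (allActs_mono hα hφ hor (taut fun v => by grind)) hα₁
  have h₂ : Provable (allActs β (φ.or ψ)) :=
    .MP (allActs_mono hβ hψ hor (taut fun v => by grind)) hβ₁
  refine ⟨.choice α β, by simpa [ActionFormula.RefFree] using ⟨hα, hβ⟩,
    cons₃ (.LU α β (φ.or ψ)) h₁ h₂ fun v => by grind, ?_⟩
  have hor' : (φ.or ψ).neg.RefFree := by simpa [Formula.RefFree] using hor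
  have h₃ : Provable ((allActs α (φ.or ψ).neg).imp (allActs α φ.neg)) :=
    allActs_mono hα hor' (by simpa [Formula.RefFree] using hφ) (taut fun v => by grind)
  have h₄ : Provable ((allActs β (φ.or ψ).neg).imp (allActs β ψ.neg)) :=
    allActs_mono hβ hor' (by simpa [Formula.RefFree] using hψ) (taut fun v => by grind)
  have h₅ : Provable ((φ.or ψ).someRefs.imp ((someActs α φ).or (someActs β ψ))) :=
    cons₃ (someRefs_or φ ψ) hα₂ hβ₂ fun v => by grind
  exact cons₄ h₃ h₄ h₅ (.LU α β (φ.or ψ).neg) fun v => by grind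

/-- The formulas boxed for the agent `a` in a list can be collected into one. -/
theorem exists_boxed_conjunction {S : Formula Atom Ag → Prop} (htop : S top)
    (hand : ∀ φ ψ, S φ → S ψ → S (.and φ ψ)) (a : Ag) {Γ : List (Formula Atom Ag)}
    (hΓ : ∀ φ, box a φ ∈ Γ → S φ) :
    ∃ φ, S φ ∧ Provable ((bigAnd Γ).imp (box a φ)) ∧
      ∀ ψ, box a ψ ∈ Γ → Provable (φ.imp ψ) := by
  induction Γ with
  | nil =>
    have h : Provable (box a (top : Formula Atom Ag)) := .NecK a (taut fun v => by simp)
    exact ⟨top, htop, h.cons fun v => by grind, by simp⟩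
  | cons χ Γ ih =>
    obtain ⟨φ, hφ, h₁, h₂⟩ := ih fun φ hφ => hΓ φ (by simp [hφ])
    by_cases hχ : ∃ ψ, χ = box a ψ
    · obtain ⟨ψ, rfl⟩ := hχ
      refine ⟨ψ.and φ, hand _ _ (hΓ ψ (by simp)) hφ, ?_, ?_⟩
      · exact cons₂ h₁ (box_and a ψ φ) fun v => by simp; tauto
      · intro θ hθ
        simp only [List.mem_cons, Formula.box.injEq, true_and] at hθ
        rcases hθ with rfl | hθ
        · exact taut fun v => by grind
        · exact (h₂ θ hθ).cons fun v => by grind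
    · refine ⟨φ, hφ, h₁.cons fun v => by grind, fun ψ hψ => h₂ ψ ?_⟩
      rcases List.mem_cons.1 hψ with h | h
      · exact absurd ⟨ψ, h.symm⟩ hχ
      · exact h

/-- The action is the choice of those synthesized for `φ ∧ ¬ψ`: each branch guarantees `φ`, and the
branch for `ψ` refutes `[α]ψ` when `φ ∧ ¬ψ` is achievable. -/
theorem exists_action_of_negBoxes (a : Ag) (hφ : φ.RefFree) {Γ : List (Formula Atom Ag)}
    (hΓ : ∀ ψ, neg (box a ψ) ∈ Γ → ψ.RefFree ∧ Synthesizable (φ.and ψ.neg)) :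
    ∃ α : ActionFormula Atom Ag, α.RefFree ∧ Provable (allActs α φ) ∧
      ∀ ψ, neg (box a ψ) ∈ Γ →
        Provable ((φ.and ψ.neg).someRefs.imp (allActs α ψ).neg) := by
  induction Γ with
  | nil =>
    -- The empty choice is the action that can never be executed.
    exact ⟨.test bot, by simpa [ActionFormula.RefFree] using isModal_bot.refFree,
      (allActs_test bot hφ).cons fun v => by grind, by simp⟩
  | cons χ Γ ih =>
    obtain ⟨α, hα, h₁, h₂⟩ := ih fun ψ hψ => hΓ ψ (by simp [hψ])
    by_cases hχ : ∃ ψ, χ = neg (box a ψ)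
    · obtain ⟨ψ, rfl⟩ := hχ
      obtain ⟨hψ, β, hβ, h₃, h₄⟩ := hΓ ψ (by simp)
      have hand : (φ.and ψ.neg).RefFree := by simpa [Formula.RefFree] using ⟨hφ, hψ⟩
      refine ⟨.choice β α, by simpa [ActionFormula.RefFree] using ⟨hβ, hα⟩, ?_, ?_⟩
      · have h₅ : Provable (allActs β φ) :=
          .MP (allActs_mono hβ hand hφ (taut fun v => by grind)) h₃
        exact cons₃ h₁ h₅ (.LU β α φ) fun v => by grind
      · intro θ hθ
        simp only [List.mem_cons, Formula.neg.injEq, Formula.box.injEq, true_and] at hθ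
        rcases hθ with rfl | hθ
        · have h₅ : Provable ((allActs β θ).imp (allActs β (φ.and θ.neg).neg)) :=
            allActs_mono hβ hψ (by simpa [Formula.RefFree] using ⟨hφ, hψ⟩)
              (taut fun v => by grind)
          exact cons₃ h₄ h₅ (.LU β α θ) fun v => by grind
        · exact cons₂ (h₂ θ hθ) (.LU β α θ) fun v => by grind
    · refine ⟨α, hα, h₁, fun ψ hψ => h₂ ψ ?_⟩
      rcases List.mem_cons.1 hψ with h | h
      · exact absurd ⟨ψ, h.symm⟩ hχ
      · exact h

theorem imp_allActs_bigAnd {α : ActionFormula Atom Ag} (hα : α.RefFree)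
    {Γ : List (Formula Atom Ag)} (hΓ : ∀ ψ ∈ Γ, ψ.RefFree)
    (h : ∀ ψ ∈ Γ, Provable (φ.imp (allActs α ψ))) :
    Provable (φ.imp (allActs α (bigAnd Γ))) := by
  induction Γ with
  | nil =>
    exact (Provable.NecL α (φ := bigAnd []) (taut fun v => by simp)).cons fun v => by grind
  | cons ψ Γ ih =>
    have hΓ' : ∀ χ ∈ Γ, χ.RefFree := fun χ hχ => hΓ χ (by simp [hχ])
    exact cons₃ (h ψ (by simp)) (ih hΓ' fun χ hχ => h χ (by simp [hχ]))
      (allActs_and α hα (hΓ ψ (by simp)) (refFree_bigAnd hΓ'))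
      fun v => by simp only [bigAnd, v.holds_imp, v.holds_iff, v.holds_and]; tauto

/-- Testing `[β]φ` before `β` makes the guarantee trivial; testing `∃φ` would not be
refinement-free. By `hneg`, `⟨?[β]φ ; β⟩φ` amounts to `[β]φ`, which `h` derives from `∃φ`. -/
theorem synthesizable_of_learnEach {β : ActionFormula Atom Ag} (hβ : β.RefFree)
    (hφ : φ.RefFree) (hneg : Provable ((allActs β φ.neg).iff (allActs β φ).neg))
    (h : Provable (φ.someRefs.imp (allActs β φ))) : Synthesizable φ := by
  have hβφ : (allActs β φ).RefFree := by simpa [Formula.RefFree] using ⟨hβ, hφ⟩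
  refine ⟨.seq (.test (allActs β φ)) β, by simp [ActionFormula.RefFree, hβφ, hβ], ?_, ?_⟩
  · exact cons₂ (.LS (.test (allActs β φ)) β φ) (allActs_test (allActs β φ) hβφ) fun v => by grind
  · exact cons₄ (.LS (.test (allActs β φ)) β φ.neg) (allActs_test (allActs β φ)
      (φ := allActs β φ.neg) (by simpa [Formula.RefFree] using ⟨hβ, hφ⟩)) hneg h
      fun v => by grind

theorem synthesizable_bigAnd {S : Formula Atom Ag → Prop} (hS : ∀ φ, S φ → φ.RefFree)
    (htop : ∀ φ, S φ → S top) (hneg : ∀ φ, S φ → S (.neg φ))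
    (hand : ∀ φ ψ, S φ → S ψ → S (.and φ ψ)) (hsynth : ∀ φ, S φ → Synthesizable φ)
    {Γ : List (Formula Atom Ag)} (hΓ : ∀ φ ∈ Γ, IsLiteral S φ) :
    Synthesizable (bigAnd Γ) := by
  have hrf : ∀ φ ∈ Γ, φ.RefFree := fun φ hφ => (hΓ φ hφ).refFree hS
  have hbox : ∀ a ψ, box a ψ ∈ Γ → S ψ := fun a ψ h => by
    cases hΓ _ h with
    | box _ h => exact h
  have hnbox : ∀ a ψ, neg (box a ψ) ∈ Γ → S ψ := fun a ψ h => by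
    cases hΓ _ h with
    | negBox _ h => exact h
  have key : ∀ a, ∃ α : ActionFormula Atom Ag, α.RefFree ∧
      (∀ ψ, box a ψ ∈ Γ → Provable (allActs α ψ)) ∧
      ∀ ψ, neg (box a ψ) ∈ Γ →
        Provable ((bigAnd Γ).someRefs.imp (box a (allActs α ψ)).neg) := by
    intro a
    -- At modal depth `0` the class `S` is empty and does not even contain `⊤`; then `Γ` has no
    -- boxes and any action will do.
    by_cases hne : ∃ ψ, S ψ
    · obtain ⟨ψ₀, hψ₀⟩ := hne
      obtain ⟨φ, hφ, h₁, h₂⟩ :=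
        exists_boxed_conjunction (htop ψ₀ hψ₀) hand a (hbox a)
      obtain ⟨α, hα, h₃, h₄⟩ := exists_action_of_negBoxes a (hS φ hφ) (Γ := Γ)
        fun ψ hψ => ⟨hS ψ (hnbox a ψ hψ),
          hsynth _ (hand _ _ hφ (hneg _ (hnbox a ψ hψ)))⟩
      refine ⟨α, hα, fun ψ hψ =>
        .MP (allActs_mono hα (hS φ hφ) (hS ψ (hbox a ψ hψ)) (h₂ ψ hψ)) h₃, fun ψ hψ => ?_⟩
      have h₅ : Provable ((bigAnd Γ).imp ((box a φ).and (box a ψ).neg)) :=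
        h₁.cons fun v => by
          have := v.holds_of_mem_bigAnd hψ
          grind
      -- Contraposed under the box: an `a`-successor where `φ ∧ ¬ψ` is achievable is one where
      -- `[α]ψ` fails.
      have h₆ : Provable ((box a (allActs α ψ)).imp (box a (φ.and ψ.neg).someRefs.neg)) :=
        box_mono a ((h₄ ψ hψ).cons fun v => by grind)
      exact cons₃ (someRefs_mono h₅) (someRefs_box_and_neg_box a φ ψ) h₆ fun v => by grind
    · refine ⟨.test top, by simpa [ActionFormula.RefFree] using isModal_top.refFree,
        fun ψ hψ => ?_, fun ψ hψ => ?_⟩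
      · exact absurd ⟨ψ, hbox a ψ hψ⟩ hne
      · exact absurd ⟨ψ, hnbox a ψ hψ⟩ hne
  choose α hα hα₁ hα₂ using key
  have hβ := learnEach_refFree hα (Finset.univ : Finset Ag).toList
  have hbox' : ∀ a {ψ : Formula Atom Ag}, ψ.RefFree →
      Provable ((allActs (learnEach α (Finset.univ : Finset Ag).toList) (box a ψ)).iff
        (box a (allActs (α a) ψ))) := fun a ψ hψ =>
    learnEach_box_of_mem (Finset.nodup_toList _) hψ (by simp)
  refine synthesizable_of_learnEach hβ (refFree_bigAnd hrf)
    (learnEach_neg _ (refFree_bigAnd hrf)) (imp_allActs_bigAnd hβ hrf fun φ hφ => ?_)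
  have hmem : Provable ((bigAnd Γ).imp φ) :=
    taut fun v => by simpa using v.holds_of_mem_bigAnd hφ
  cases hΓ φ hφ with
  | atom p =>
    exact cons₃ (someRefs_mono hmem) (someRefs_of_isPropositional (.atom p))
      (learnEach_atom (α := α) _ p) fun v => by simp only [v.holds_imp, v.holds_iff]; tauto
  | negAtom p =>
    exact cons₄ (someRefs_mono hmem) (someRefs_of_isPropositional (.neg (.atom p)))
      (learnEach_atom (α := α) _ p)
      (learnEach_neg (α := α) _ (φ := .atom p) (IsModal.atom p).refFree)
      fun v => by simp only [v.holds_imp, v.holds_iff, v.holds_neg]; tauto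
  | box a h =>
    exact cons₂ (.NecK a (hα₁ a _ hφ)) (hbox' a (hS _ h))
      fun v => by simp only [v.holds_imp, v.holds_iff]; tauto
  | @negBox a ψ h =>
    exact cons₃ (hα₂ a _ hφ) (hbox' a (hS _ h))
      (learnEach_neg _ (φ := box a ψ) (by simpa [Formula.RefFree] using hS _ h))
      fun v => by simp only [v.holds_imp, v.holds_iff, v.holds_neg]; tauto

-- Boolean combinations and induction on modal depth

/-- Nesting depth of the boxes of a modal formula. -/
def Formula.modalDepth {Atom : Type u} {Ag : Type v} : Formula Atom Ag → ℕ
  | .atom _ => 0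
  | .neg φ => φ.modalDepth
  | .and φ ψ => max φ.modalDepth ψ.modalDepth
  | .box _ φ => φ.modalDepth + 1
  | .allActs _ _ => 0
  | .allRefs _ => 0

/-- If synthesis from a conjunction of literals and `ρ` is possible, then so it is when a Boolean
combination of literals is added. -/
theorem synthesizable_and_of_literals {S : Formula Atom Ag → Prop}
    (hS : ∀ φ, S φ → φ.RefFree) (hφ : φ.IsModal)
    (hbox : ∀ ψ : Formula Atom Ag, ψ.IsModal → ψ.modalDepth < φ.modalDepth → S ψ) :
    ∀ ρ : Formula Atom Ag, ρ.RefFree →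
      (∀ Γ : List (Formula Atom Ag), (∀ θ ∈ Γ, IsLiteral S θ) →
        Synthesizable ((bigAnd Γ).and ρ)) →
      ∀ Γ : List (Formula Atom Ag), (∀ θ ∈ Γ, IsLiteral S θ) →
        Synthesizable ((bigAnd Γ).and (φ.and ρ)) ∧
          Synthesizable ((bigAnd Γ).and (φ.neg.and ρ)) := by
  have lit : ∀ θ : Formula Atom Ag, IsLiteral S θ → ∀ ρ : Formula Atom Ag,
      (∀ Γ : List (Formula Atom Ag), (∀ θ ∈ Γ, IsLiteral S θ) →
        Synthesizable ((bigAnd Γ).and ρ)) →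
      ∀ Γ : List (Formula Atom Ag), (∀ θ ∈ Γ, IsLiteral S θ) →
        Synthesizable ((bigAnd Γ).and (θ.and ρ)) := fun θ hθ ρ hρ Γ hΓ =>
    (hρ (θ :: Γ) (by simpa using ⟨hθ, hΓ⟩)).congr (taut fun v => by grind)
  -- Synthesizability is not directly closed under conjunction, so `ρ` holds the conjuncts still to
  -- be decomposed while `Γ` collects literals. Proving the cases `φ` and `¬φ` together lets
  -- negation swap them.
  induction hφ with
  | atom p => exact fun ρ _ h Γ hΓ => ⟨lit _ (.atom p) ρ h Γ hΓ, lit _ (.negAtom p) ρ h Γ hΓ⟩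
  | @neg φ hφ ih =>
    intro ρ hρ h Γ hΓ
    obtain ⟨h₁, h₂⟩ := ih (by simpa [Formula.modalDepth] using hbox) ρ hρ h Γ hΓ
    exact ⟨h₂, h₁.congr (taut fun v => by grind)⟩
  | @and φ ψ hφ hψ ih₁ ih₂ =>
    intro ρ hρ h Γ hΓ
    simp only [Formula.modalDepth] at hbox
    have hi₁ := ih₁ fun χ hχ hlt => hbox χ hχ (by omega)
    have hi₂ := ih₂ fun χ hχ hlt => hbox χ hχ (by omega)
    have hφ' := hφ.refFree
    have hψ' := hψ.refFree
    have hΓ' : (bigAnd Γ).RefFree := refFree_bigAnd fun θ hθ => (hΓ θ hθ).refFree hS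
    constructor
    · exact (hi₁ (ψ.and ρ) (by simpa [Formula.RefFree] using ⟨hψ', hρ⟩)
        (fun Δ hΔ => (hi₂ ρ hρ h Δ hΔ).1) Γ hΓ).1.congr (taut fun v => by grind)
    -- A negated conjunction splits into a disjunction, the only place where choice between
    -- alternatives enters.
    · refine (Synthesizable.or (by simp [Formula.RefFree, hΓ', hφ', hρ])
        (by simp [Formula.RefFree, hΓ', hψ', hρ])
        (hi₁ ρ hρ h Γ hΓ).2 (hi₂ ρ hρ h Γ hΓ).2).congr (taut fun v => ?_)
      simp only [v.holds_iff, v.holds_or, v.holds_and, v.holds_neg]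
      tauto
  | box a hφ _ =>
    have := hbox _ hφ (by simp [Formula.modalDepth])
    exact fun ρ _ h Γ hΓ => ⟨lit _ (.box a this) ρ h Γ hΓ, lit _ (.negBox a this) ρ h Γ hΓ⟩

theorem Formula.IsModal.synthesizable {φ : Formula Atom Ag} (hφ : φ.IsModal) :
    Synthesizable φ := by
  induction hn : φ.modalDepth using Nat.strong_induction_on generalizing φ with
  | _ n ih =>
    let S : Formula Atom Ag → Prop := fun ψ => ψ.IsModal ∧ ψ.modalDepth < n
    have hS : ∀ ψ, S ψ → ψ.RefFree := fun ψ h => h.1.refFree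
    have hlit : ∀ Γ : List (Formula Atom Ag), (∀ θ ∈ Γ, IsLiteral S θ) →
        Synthesizable ((bigAnd Γ).and top) := fun Γ hΓ =>
      (synthesizable_bigAnd hS
        (fun ψ h => ⟨isModal_top, by
          have := h.2
          simp only [top, bot, Formula.modalDepth]
          omega⟩)
        (fun ψ h => ⟨h.1.neg, by simpa [Formula.modalDepth] using h.2⟩)
        (fun ψ χ h₁ h₂ => ⟨h₁.1.and h₂.1, by
          simpa [Formula.modalDepth] using ⟨h₁.2, h₂.2⟩⟩)
        (fun ψ h => ih _ h.2 h.1 rfl) hΓ).congr (taut fun v => by grind)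
    exact (synthesizable_and_of_literals hS hφ (fun ψ hψ hlt => ⟨hψ, hn ▸ hlt⟩) top
      isModal_top.refFree hlit [] (by simp)).1.congr (taut fun v => by grind)

end Synthesis

end ActionFormulaLogic

theorem mainTheorem4 {Atom : Type*} {Ag : Type*} [Nonempty Atom] [Fintype Ag]
    (φ : ActionFormulaLogic.Formula Atom Ag) (hφ : φ.RefFree) :
    ∃ α : ActionFormulaLogic.ActionFormula Atom Ag, α.RefFree ∧
      ActionFormulaLogic.Provable (.allActs α φ) ∧
      ActionFormulaLogic.Provable
        (ActionFormulaLogic.Formula.imp (ActionFormulaLogic.Formula.someRefs φ)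
          (ActionFormulaLogic.Formula.someActs α φ)) := by
  obtain ⟨ψ, hψ, h⟩ := ActionFormulaLogic.exists_isModal_iff φ hφ
  exact hψ.synthesizable.congr h.iff_symm
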